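/- \textbf{Theorem.} Every class~2 standard sequent calculus has the analytic cut property. The terms are defined as follows. \emph{Formulas and sequents.} Fix a set $\mathcal L$ of connectives, each with a finite arity $\ge 0$, and a set of variables; formulas are built from these in the usual way, and $C^\circ$ denotes a formula with outermost connective $\circ$. An $\ell$-formula is a formula labelled $\mathtt l$ (left) or $\mathtt r$ (right), written $A^{\mathtt l}$ or $A^{\mathtt r}$; $\overline{A^{\mathtt l}}=A^{\mathtt r}$, $\overline{A^{\mathtt r}}=A^{\mathtt l}$, and $\overline{\mathcal C}=\{\overline A\mid A\in\mathcal C\}$. Subformula relations ignore labels. A sequent is a finite multiset of $\ell$-formulas; a comma is multiset union and $\{A\}^p$ is $p$ copies of $A$. \emph{Simple rules.} A simple left rule $R$ for $\circ$ consists of a number $M\ge 0$ of premises, a set $\Lambda(R)$ of tuples $(C^{\circ\,\mathtt l},\Lambda_1,\dots,\Lambda_M)$, where each $\Lambda_m$ is a finite multiset of $\ell$-formulas that are proper subformulas of $C^\circ$, and a set $\mathcal C(R)$ of $\ell$-formulas (the context restriction), such that $\Lambda(R)$ and $\mathcal C(R)$ are closed under replacing all occurrences of a variable by a formula, and every $C^{\circ\,\mathtt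 l}$ is the first component of some tuple in $\Lambda(R)$. Its instances derive $\Gamma,C^{\circ\,\mathtt l}$ from the premises $\Gamma,\Lambda_1$; …; $\Gamma,\Lambda_M$, for $(C^{\circ\,\mathtt l},\Lambda_1,\dots,\Lambda_M)\in\Lambda(R)$ and $\Gamma$ a finite multiset of elements of $\mathcal C(R)$. Simple right rules are defined in the same way with $\mathtt r$ in place of the label $\mathtt l$ of the principal formula. $R$ has no context restriction if $\mathcal C(R)$ is the set of all $\ell$-formulas. \emph{Standard calculi.} A standard calculus $\mathbb S$ has the initial sequents $x^{\mathtt l},x^{\mathtt r}$ ($x$ a variable), the structural rules of weakening (from $\Gamma$ infer $\Gamma,\Delta$), contraction (from $\Gamma$ infer $\Gamma^*$, where $\Gamma^*$ has the same support as $\Gamma$ and no larger multiplicities) and multicut (from $\Gamma,\{C^{\mathtt r}\}^p$ and $\Delta,\{C^{\mathtt l}\}^q$ with $p,q\ne 0$ infer $\Gamma,\Delta$; $C$ is the cut formula), and, for every connective $\circ$, exactly one simple left rule $(\circ\mathtt l)$ and one simple right rule $(\circ\mathtt r)$. A deduction from a set $\Omega$ of sequents is a finite tree of rule instances whose leaves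 (other than conclusions of rules without premises) are initial sequents or members of $\Omega$; a proof is a deduction from $\emptyset$. A multicut is analytic if its cut formula is a subformula of some formula in its conclusion. A proof is cut-free if it contains no multicut, and locally analytic if all its multicuts are analytic. $\mathbb S$ has the \emph{analytic cut property} if every provable sequent has a locally analytic proof. \emph{Properties of connectives.} For a connective $\circ$ of $\mathbb S$: \begin{itemize} \item $\circ$ is left-invertible if, whenever $(C^{\circ\,\mathtt l},\Lambda_1,\dots,\Lambda_M)\in\Lambda(\circ\mathtt l)$, then for every sequent $\Gamma$, every proof $\beta$ of $\Gamma,C^{\circ\,\mathtt l}$ and every $m\le M$ there is a proof $\beta_m$ of $\Gamma,\Lambda_m$ such that $\beta_m$ is cut-free if $\beta$ is, and, if $\beta$ is locally analytic, every multicut in $\beta_m$ is analytic or has a proper subformula of $C^\circ$ as its cut formula. Right-invertible: the same with $\mathtt r$ for the label $\mathtt l$. \item $\circ$ is leftable if for every $C^\circ$ and every simple rule $R$ of $\mathbb S$, $C^{\circ\,\mathtt l}\in\mathcal C(R)$ implies that $R$ has no context restriction; weakly leftable if $C^{\circ\,\mathtt l}\in\mathcal C(R)$ always implies $\mathcal C(\circ\mathtt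 r)\subseteq\mathcal C(R)$; inverse leftable if $C^{\circ\,\mathtt l}\in\mathcal C(R)$ always implies $\overline{\mathcal C(\circ\mathtt l)}\subseteq\mathcal C(R)$. Rightable, weakly rightable and inverse rightable are defined by exchanging $\mathtt l$ and $\mathtt r$. \item $\circ$ is class~1 if it is (1) left- and right-invertible, or (2) leftable and weakly rightable, or (3) rightable and weakly leftable. It is class~2 if it is class~1, or (4) weakly leftable and inverse rightable, or (5) weakly rightable and inverse leftable. \end{itemize} \emph{Class 2 calculi.} A standard calculus is class~2 if it is consistent (the empty sequent is not provable), satisfies axiom expansion ($A^{\mathtt l},A^{\mathtt r}$ has a cut-free proof for every formula $A$), satisfies principal case reductions (whenever $(C^{\circ\,\mathtt l},\Lambda_1,\dots,\Lambda_M)\in\Lambda(\circ\mathtt l)$ and $(C^{\circ\,\mathtt r},\Sigma_1,\dots,\Sigma_N)\in\Lambda(\circ\mathtt r)$, there is a deduction of the empty sequent from $\{\Lambda_1,\dots,\Lambda_M,\Sigma_1,\dots,\Sigma_N\}$ that uses no simple rules), and every connective in it is class~2. -/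

import Mathlib

namespace SeqCalc

universe u v

/-- Formulas over variables `V` and connectives `L`, where `c : L` has arity `ar c`. -/
inductive Formula (V : Type u) {L : Type v} (ar : L → ℕ) : Type (max u v) where
  | var (x : V) : Formula V ar
  | app (c : L) (args : Fin (ar c) → Formula V ar) : Formula V ar

/-- `Subformula A B`: the formula `A` is a (not necessarily proper) subformula of `B`. -/
inductive Subformula {V : Type u} {L : Type v} {ar : L → ℕ} :
    Formula V ar → Formula V ar → Prop where
  | refl (A : Formula V ar) : Subformula A A
  | arg (A : Formula V ar) (c : L) (args : Fin (ar c) → Formula V ar) (i : Fin (ar c))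
      (h : Subformula A (args i)) : Subformula A (Formula.app c args)

/-- `A` is a proper subformula of `B`. -/
def ProperSubformula {V : Type u} {L : Type v} {ar : L → ℕ} (A B : Formula V ar) : Prop :=
  Subformula A B ∧ A ≠ B

open Classical in
/-- Replace all occurrences of the variable `x` by the formula `A`. -/
noncomputable def Formula.subst {V : Type u} {L : Type v} {ar : L → ℕ}
    (x : V) (A : Formula V ar) : Formula V ar → Formula V ar
  | .var y => if y = x then A else .var y
  | .app c args => .app c (fun i => Formula.subst x A (args i))

/-- The labels: left (antecedent) and right (succedent). -/
inductive Side : Type where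
  | left : Side
  | right : Side

/-- The inverse of a label. -/
def Side.inv : Side → Side
  | .left => .right
  | .right => .left

/-- Labelled formulas. -/
@[ext]
structure LFormula (V : Type u) {L : Type v} (ar : L → ℕ) : Type (max u v) where
  side : Side
  formula : Formula V ar

/-- Invert the label of a labelled formula. -/
def LFormula.inv {V : Type u} {L : Type v} {ar : L → ℕ} (A : LFormula V ar) : LFormula V ar :=
  ⟨A.side.inv, A.formula⟩

/-- Uniform substitution in a labelled formula. -/
noncomputable def LFormula.subst {V : Type u} {L : Type v} {ar : L → ℕ}
    (x : V) (A : Formula V ar) (B : LFormula V ar) : LFormula V ar :=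
  ⟨B.side, Formula.subst x A B.formula⟩

/-- Sequents are finite multisets of labelled formulas. -/
abbrev Sequent (V : Type u) {L : Type v} (ar : L → ℕ) : Type (max u v) :=
  Multiset (LFormula V ar)

/-- The data of a simple rule for the connective `c`. The label of the principal formula
is not stored here: `Calculus.rule .left c` is read as a left rule, `Calculus.rule .right c`
as a right rule. A pair `(args, prems) ∈ tuples` stands for the tuple whose principal formula is
`c(args)` and whose auxiliary multisets are `prems 0, …, prems (arity - 1)`. -/
structure SimpleRule (V : Type u) {L : Type v} (ar : L → ℕ) (c : L) : Type (max u v) where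
  /-- the number of premises -/
  arity : ℕ
  /-- the allowed principal formulas with their auxiliary multisets -/
  tuples : Set ((Fin (ar c) → Formula V ar) × (Fin arity → Sequent V ar))
  /-- the context restriction: the labelled formulas allowed in the context -/
  context : Set (LFormula V ar)
  aux_proper : ∀ args prems, (args, prems) ∈ tuples → ∀ m, ∀ A ∈ prems m,
    ProperSubformula A.formula (Formula.app c args)
  tuples_subst : ∀ args prems, (args, prems) ∈ tuples → ∀ (x : V) (A : Formula V ar),
    ((fun i => Formula.subst x A (args i)), (fun m => (prems m).map (LFormula.subst x A))) ∈ tuples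
  context_subst : ∀ B ∈ context, ∀ (x : V) (A : Formula V ar), LFormula.subst x A B ∈ context
  total : ∀ args, ∃ prems, (args, prems) ∈ tuples

/-- A standard sequent calculus: one simple left rule and one simple right rule
for every connective. The initial sequents and the structural rules are common to all standard
calculi and built into `Deduction`. -/
structure Calculus (V : Type u) {L : Type v} (ar : L → ℕ) : Type (max u v) where
  rule : Side → (c : L) → SimpleRule V ar c

/-- `Γ'` is a contraction of `Γ`: same support, multiplicities not larger. -/
def IsContraction {V : Type u} {L : Type v} {ar : L → ℕ} (Γ' Γ : Sequent V ar) : Prop :=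
  Γ' ≤ Γ ∧ ∀ A, A ∈ Γ' ↔ A ∈ Γ

/-- Deductions in the calculus `S` from the set of sequents `Ω`, as trees indexed by
their endsequent. -/
inductive Deduction {V : Type u} {L : Type v} {ar : L → ℕ} (S : Calculus V ar)
    (Ω : Set (Sequent V ar)) : Sequent V ar → Type (max u v) where
  | hyp (Γ : Sequent V ar) (h : Γ ∈ Ω) : Deduction S Ω Γ
  | init (x : V) : Deduction S Ω {⟨.left, .var x⟩, ⟨.right, .var x⟩}
  | weakening (Γ Δ : Sequent V ar) (d : Deduction S Ω Γ) : Deduction S Ω (Γ + Δ)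
  | contraction (Γ Γ' : Sequent V ar) (h : IsContraction Γ' Γ) (d : Deduction S Ω Γ) :
      Deduction S Ω Γ'
  | mcut (Γ Δ : Sequent V ar) (C : Formula V ar) (p q : ℕ) (hp : p ≠ 0) (hq : q ≠ 0)
      (d₁ : Deduction S Ω (Γ + Multiset.replicate p ⟨.right, C⟩))
      (d₂ : Deduction S Ω (Δ + Multiset.replicate q ⟨.left, C⟩)) : Deduction S Ω (Γ + Δ)
  | simple (s : Side) (c : L) (args : Fin (ar c) → Formula V ar)
      (prems : Fin (S.rule s c).arity → Sequent V ar)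
      (h : (args, prems) ∈ (S.rule s c).tuples)
      (Γ : Sequent V ar) (hΓ : ∀ A ∈ Γ, A ∈ (S.rule s c).context)
      (d : ∀ m, Deduction S Ω (Γ + prems m)) :
      Deduction S Ω (Γ + {⟨s, .app c args⟩})

/-- Every multicut of the deduction satisfies `P C Γ`, where `C` is its cut formula and
`Γ` is its conclusion. -/
def Deduction.AllCuts {V : Type u} {L : Type v} {ar : L → ℕ} {S : Calculus V ar}
    {Ω : Set (Sequent V ar)} (P : Formula V ar → Sequent V ar → Prop) :
    {Γ : Sequent V ar} → Deduction S Ω Γ → Prop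
  | _, .hyp _ _ => True
  | _, .init _ => True
  | _, .weakening _ _ d => d.AllCuts P
  | _, .contraction _ _ _ d => d.AllCuts P
  | _, .mcut Γ Δ C _ _ _ _ d₁ d₂ => P C (Γ + Δ) ∧ d₁.AllCuts P ∧ d₂.AllCuts P
  | _, .simple _ _ _ _ _ _ _ d => ∀ m, (d m).AllCuts P

/-- The deduction uses only structural rules, i.e. no simple rule. -/
def Deduction.StructuralOnly {V : Type u} {L : Type v} {ar : L → ℕ} {S : Calculus V ar}
    {Ω : Set (Sequent V ar)} : {Γ : Sequent V ar} → Deduction S Ω Γ → Prop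
  | _, .hyp _ _ => True
  | _, .init _ => True
  | _, .weakening _ _ d => d.StructuralOnly
  | _, .contraction _ _ _ d => d.StructuralOnly
  | _, .mcut _ _ _ _ _ _ _ d₁ d₂ => d₁.StructuralOnly ∧ d₂.StructuralOnly
  | _, .simple _ _ _ _ _ _ _ _ => False

/-- A multicut with cut formula `C` and conclusion `Γ` is analytic. -/
def AnalyticCut {V : Type u} {L : Type v} {ar : L → ℕ}
    (C : Formula V ar) (Γ : Sequent V ar) : Prop :=
  ∃ A ∈ Γ, Subformula C A.formula

/-- The deduction contains no multicut. -/
def Deduction.CutFree {V : Type u} {L : Type v} {ar : L → ℕ} {S : Calculus V ar}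
    {Ω : Set (Sequent V ar)} {Γ : Sequent V ar} (d : Deduction S Ω Γ) : Prop :=
  d.AllCuts (fun _ _ => False)

/-- All multicuts of the deduction are analytic. -/
def Deduction.LocallyAnalytic {V : Type u} {L : Type v} {ar : L → ℕ} {S : Calculus V ar}
    {Ω : Set (Sequent V ar)} {Γ : Sequent V ar} (d : Deduction S Ω Γ) : Prop :=
  d.AllCuts AnalyticCut

/-- A proof is a deduction without hypotheses. -/
abbrev Proof {V : Type u} {L : Type v} {ar : L → ℕ} (S : Calculus V ar)
    (Γ : Sequent V ar) : Type (max u v) :=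
  Deduction S ∅ Γ

namespace Calculus

variable {V : Type u} {L : Type v} {ar : L → ℕ}

def Provable (S : Calculus V ar) (Γ : Sequent V ar) : Prop :=
  Nonempty (Proof S Γ)

def AnalyticCutProperty (S : Calculus V ar) : Prop :=
  ∀ Γ : Sequent V ar, S.Provable Γ → ∃ d : Proof S Γ, d.LocallyAnalytic

def AxiomExpansion (S : Calculus V ar) : Prop :=
  ∀ A : Formula V ar, ∃ d : Proof S {⟨.left, A⟩, ⟨.right, A⟩}, d.CutFree

def PrincipalCaseReductions (S : Calculus V ar) : Prop :=
  ∀ (c : L) (args : Fin (ar c) → Formula V ar)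
    (Λ : Fin (S.rule .left c).arity → Sequent V ar)
    (Θ : Fin (S.rule .right c).arity → Sequent V ar),
    (args, Λ) ∈ (S.rule .left c).tuples → (args, Θ) ∈ (S.rule .right c).tuples →
    ∃ d : Deduction S (Set.range Λ ∪ Set.range Θ) 0, d.StructuralOnly

def Consistent (S : Calculus V ar) : Prop :=
  ¬ S.Provable 0

/-- Left-invertibility (`s = .left`) and right-invertibility (`s = .right`) of `c`. -/
def Invertible (S : Calculus V ar) (s : Side) (c : L) : Prop :=
  ∀ (args : Fin (ar c) → Formula V ar) (Λ : Fin (S.rule s c).arity → Sequent V ar),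
    (args, Λ) ∈ (S.rule s c).tuples →
    ∀ (Γ : Sequent V ar) (d : Proof S (Γ + {⟨s, .app c args⟩})) (m : Fin (S.rule s c).arity),
      ∃ d' : Proof S (Γ + Λ m),
        (d.CutFree → d'.CutFree) ∧
        (d.LocallyAnalytic → d'.AllCuts (fun D Δ =>
          AnalyticCut D Δ ∨ ProperSubformula D (.app c args)))

/-- `c` is leftable (`s = .left`) or rightable (`s = .right`): a simple rule
allowing some formula with principal connective `c` and label `s` in its context has no context
restriction. -/
def Shiftable (S : Calculus V ar) (s : Side) (c : L) : Prop :=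
  ∀ (args : Fin (ar c) → Formula V ar) (t : Side) (e : L),
    (⟨s, .app c args⟩ : LFormula V ar) ∈ (S.rule t e).context →
    (S.rule t e).context = Set.univ

/-- `c` is weakly leftable (`s = .left`) or weakly rightable (`s = .right`). -/
def WeaklyShiftable (S : Calculus V ar) (s : Side) (c : L) : Prop :=
  ∀ (args : Fin (ar c) → Formula V ar) (t : Side) (e : L),
    (⟨s, .app c args⟩ : LFormula V ar) ∈ (S.rule t e).context →
    (S.rule s.inv c).context ⊆ (S.rule t e).context

/-- `c` is inverse leftable (`s = .left`) or inverse rightable (`s = .right`). -/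
def InverseShiftable (S : Calculus V ar) (s : Side) (c : L) : Prop :=
  ∀ (args : Fin (ar c) → Formula V ar) (t : Side) (e : L),
    (⟨s, .app c args⟩ : LFormula V ar) ∈ (S.rule t e).context →
    LFormula.inv '' (S.rule s c).context ⊆ (S.rule t e).context

/-- Class 1 connectives. -/
def ClassOne (S : Calculus V ar) (c : L) : Prop :=
  (S.Invertible .left c ∧ S.Invertible .right c) ∨
  (S.Shiftable .left c ∧ S.WeaklyShiftable .right c) ∨
  (S.Shiftable .right c ∧ S.WeaklyShiftable .left c)

/-- Class 2 connectives. -/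
def ClassTwo (S : Calculus V ar) (c : L) : Prop :=
  S.ClassOne c ∨
  (S.WeaklyShiftable .left c ∧ S.InverseShiftable .right c) ∨
  (S.WeaklyShiftable .right c ∧ S.InverseShiftable .left c)

/-- Class 2 calculi. -/
structure IsClassTwo (S : Calculus V ar) : Prop where
  consistent : S.Consistent
  principalCaseReductions : S.PrincipalCaseReductions
  axiomExpansion : S.AxiomExpansion
  connectives : ∀ c : L, S.ClassTwo c

end Calculus

end SeqCalc

namespace SeqCalc

variable {V : Type*} {L : Type*} {ar : L → ℕ}

/-! ### Subformulas, substitution and labels. -/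

theorem Subformula.trans {A B C : Formula V ar} (h₁ : Subformula A B) (h₂ : Subformula B C) :
    Subformula A C := by
  induction h₂ with
  | refl => exact h₁
  | arg c args i _ ih => exact .arg _ _ _ i ih

/-- `A` is a subformula of an immediate subformula of `C`. -/
def ArgSubformula (A : Formula V ar) : Formula V ar → Prop
  | .var _ => False
  | .app c args => ∃ i : Fin (ar c), Subformula A (args i)

theorem Subformula.eq_or_argSubformula {A C : Formula V ar} (h : Subformula A C) :
    A = C ∨ ArgSubformula A C := by
  cases h with
  | refl => exact .inl rfl
  | arg c args i h => exact .inr ⟨i, h⟩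

theorem ProperSubformula.argSubformula {A C : Formula V ar} (h : ProperSubformula A C) :
    ArgSubformula A C :=
  h.1.eq_or_argSubformula.resolve_left h.2

theorem Subformula.trans_argSubformula {A B C : Formula V ar} (h : Subformula A B)
    (hB : ArgSubformula B C) : ArgSubformula A C := by
  cases C with
  | var x => exact hB
  | app c args => exact hB.imp fun i hi => h.trans hi

theorem ArgSubformula.subformula {A C : Formula V ar} (h : ArgSubformula A C) :
    Subformula A C := by
  cases C with
  | var x => exact h.elim
  | app c args => exact .arg _ _ _ h.choose h.choose_spec

theorem finite_subformulas (B : Formula V ar) : {A | Subformula A B}.Finite := by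
  induction B with
  | var x =>
    refine (Set.finite_singleton (Formula.var x)).subset fun A hA => ?_
    cases hA
    rfl
  | app c args ih =>
    refine ((Set.finite_iUnion ih).insert (Formula.app c args)).subset fun A hA => ?_
    cases hA with
    | refl => exact .inl rfl
    | arg _ _ i h => exact .inr (Set.mem_iUnion.2 ⟨i, h⟩)

theorem Subformula.subst {A B : Formula V ar} (h : Subformula A B) (x : V) (D : Formula V ar) :
    Subformula (Formula.subst x D A) (Formula.subst x D B) := by
  induction h with
  | refl => exact .refl _
  | arg c args i _ ih =>
    rw [Formula.subst]
    exact .arg _ _ _ i ih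

theorem Formula.subst_var_self (x : V) (D : Formula V ar) :
    Formula.subst x D (.var x) = D := by
  simp [Formula.subst]

theorem Formula.subst_eq_self {x : V} {B : Formula V ar} (D : Formula V ar)
    (h : ¬ Subformula (.var x) B) : Formula.subst x D B = B := by
  induction B with
  | var y =>
    have : y ≠ x := by
      rintro rfl
      exact h (.refl _)
    simp [Formula.subst, this]
  | app c args ih =>
    rw [Formula.subst]
    congr 1
    funext i
    exact ih i fun hi => h (.arg _ _ _ i hi)

@[simp]
theorem Side.inv_inv (s : Side) : s.inv.inv = s := by
  cases s <;> rfl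

theorem Side.eq_or_eq_inv (s t : Side) : t = s ∨ t = s.inv := by
  cases s <;> cases t <;> simp [Side.inv]

@[simp]
theorem LFormula.inv_inv (A : LFormula V ar) : A.inv.inv = A := by
  simp [LFormula.inv]

theorem AnalyticCut.mono {C : Formula V ar} {Γ Δ : Sequent V ar} (h : AnalyticCut C Γ)
    (hs : Γ ⊆ Δ) : AnalyticCut C Δ := by
  obtain ⟨A, hA, hC⟩ := h
  exact ⟨A, hs hA, hC⟩

theorem Deduction.AllCuts.imp {S : Calculus V ar} {Ω : Set (Sequent V ar)}
    {P Q : Formula V ar → Sequent V ar → Prop} (hPQ : ∀ C Γ, P C Γ → Q C Γ)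
    {Γ : Sequent V ar} {d : Deduction S Ω Γ} (h : d.AllCuts P) : d.AllCuts Q := by
  induction d with
  | hyp | init => trivial
  | weakening Γ Δ d ih => exact ih h
  | contraction Γ Γ' hc d ih => exact ih h
  | mcut Γ Δ C p q hp hq d₁ d₂ ih₁ ih₂ => exact ⟨hPQ _ _ h.1, ih₁ h.2.1, ih₂ h.2.2⟩
  | simple s c args prems ht Γ hΓ d ih => exact fun m => ih m (h m)

/-! ### Derivability with restricted cuts. -/

/-- `Γ` has a proof all of whose multicuts satisfy `P`. -/
def Derivable (S : Calculus V ar) (P : Formula V ar → Sequent V ar → Prop)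
    (Γ : Sequent V ar) : Prop :=
  ∃ d : Proof S Γ, d.AllCuts P

namespace Derivable

variable {S : Calculus V ar} {P Q : Formula V ar → Sequent V ar → Prop} {Γ Δ : Sequent V ar}

theorem imp (hPQ : ∀ C Γ, P C Γ → Q C Γ) (h : Derivable S P Γ) : Derivable S Q Γ :=
  ⟨h.choose, h.choose_spec.imp hPQ⟩

/-- Weakening followed by contraction makes multiplicities irrelevant, so sequents are compared only
by their supports from here on. -/
theorem mono (h : Derivable S P Γ) (hs : Γ ⊆ Δ) : Derivable S P Δ := by
  obtain ⟨d, hd⟩ := h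
  have hc : IsContraction Δ (Γ + Δ) := by
    refine ⟨Multiset.le_add_left _ _, fun A => ?_⟩
    rw [Multiset.mem_add]
    exact ⟨.inr, fun h => h.elim (fun h => hs h) id⟩
  exact ⟨.contraction (Γ + Δ) Δ hc (.weakening Γ Δ d), hd⟩

theorem cut (hP : ∀ C Γ Δ, P C Γ → Γ ⊆ Δ → P C Δ) {C : Formula V ar} (hC : P C Γ) (s : Side)
    (h₁ : Derivable S P (⟨s, C⟩ ::ₘ Γ)) (h₂ : Derivable S P (⟨s.inv, C⟩ ::ₘ Γ)) :
    Derivable S P Γ := by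
  have key : ∀ t : Side, Derivable S P (Γ + Multiset.replicate 1 ⟨t, C⟩) := by
    intro t
    rcases s.eq_or_eq_inv t with rfl | rfl
    · exact h₁.mono fun A => by simp [or_comm]
    · exact h₂.mono fun A => by simp [or_comm]
  obtain ⟨d₁, hd₁⟩ := key .right
  obtain ⟨d₂, hd₂⟩ := key .left
  have : Derivable S P (Γ + Γ) :=
    ⟨.mcut Γ Γ C 1 1 one_ne_zero one_ne_zero d₁ d₂, hP _ _ _ hC (Multiset.subset_of_le (Multiset.le_add_right _ _)),
      hd₁, hd₂⟩
  exact this.mono fun A => by simp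

theorem simple {s : Side} {c : L} {args : Fin (ar c) → Formula V ar}
    {prems : Fin (S.rule s c).arity → Sequent V ar} (ht : (args, prems) ∈ (S.rule s c).tuples)
    (hΓ : ∀ A ∈ Γ, A ∈ (S.rule s c).context) (h : ∀ m, Derivable S P (Γ + prems m)) :
    Derivable S P (Γ + {⟨s, .app c args⟩}) := by
  choose d hd using h
  exact ⟨.simple s c args prems ht Γ hΓ d, hd⟩

theorem of_axiomExpansion (hS : S.AxiomExpansion) {A : LFormula V ar} (h₁ : A ∈ Γ)
    (h₂ : A.inv ∈ Γ) : Derivable S P Γ := by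
  obtain ⟨d, hd⟩ := hS A.formula
  refine mono ⟨d, hd.imp fun _ _ h => h.elim⟩ fun B hB => ?_
  obtain ⟨s, A⟩ := A
  cases s <;> simp only [LFormula.inv, Side.inv, Multiset.insert_eq_cons, Multiset.mem_cons,
    Multiset.mem_singleton] at * <;> rcases hB with rfl | rfl <;> assumption

open Classical in
/-- Cutting out all the formulas of a finite list: it suffices to derive the sequent extended
by an arbitrary labelling of the list. -/
theorem of_forall_labelling (hP : ∀ C Γ Δ, P C Γ → Γ ⊆ Δ → P C Δ) (F : List (Formula V ar)) :
    ∀ Γ : Sequent V ar, (∀ C ∈ F, P C Γ) →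
      (∀ v : Formula V ar → Side,
        Derivable S P (Γ + (F.map fun A => (⟨v A, A⟩ : LFormula V ar) : List _))) →
      Derivable S P Γ := by
  induction F with
  | nil =>
    intro Γ _ h
    exact (h fun _ => .left).mono (by simp)
  | cons A F ih =>
    intro Γ hF h
    have key : ∀ t : Side, Derivable S P (⟨t, A⟩ ::ₘ Γ) := by
      intro t
      refine ih _ (fun C hC => hP _ _ _ (hF C (List.mem_cons_of_mem _ hC))
        (Multiset.subset_cons _ _)) fun v => ?_
      -- `A` may recur in `F` with another label under `v`; overriding `v` at `A` keeps the
      -- labelling single-valued.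
      refine (h (Function.update v A t)).mono fun B hB => ?_
      simp only [List.map_cons, Function.update_self, Multiset.mem_add, Multiset.mem_coe,
        List.mem_cons, List.mem_map, Multiset.mem_cons] at hB ⊢
      rcases hB with hB | hB | ⟨D, hD, rfl⟩
      · exact .inl (.inr hB)
      · exact .inl (.inl hB)
      · by_cases hDA : D = A
        · subst hDA
          simp
        · exact .inr ⟨D, hD, by simp [hDA]⟩
    exact cut hP (hF A List.mem_cons_self) .left (key .left) (key .right)

theorem of_forall_labelling_of_finite (hP : ∀ C Γ Δ, P C Γ → Γ ⊆ Δ → P C Δ)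
    {F : Set (Formula V ar)} (hF : F.Finite) (hFP : ∀ C ∈ F, P C Γ)
    (h : ∀ (v : Formula V ar → Side) (X : Sequent V ar),
      (∀ A, A ∈ X ↔ A.formula ∈ F ∧ A.side = v A.formula) → Derivable S P (Γ + X)) :
    Derivable S P Γ := by
  refine of_forall_labelling hP hF.toFinset.toList Γ (fun C hC => hFP C (by simpa using hC))
    fun v => h v _ fun A => ?_
  simp only [Multiset.mem_coe, List.mem_map, Finset.mem_toList, Set.Finite.mem_toFinset]
  constructor
  · rintro ⟨B, hB, rfl⟩
    exact ⟨hB, rfl⟩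
  · rintro ⟨h₁, h₂⟩
    exact ⟨A.formula, h₁, by ext <;> simp [h₂]⟩

end Derivable

/-! ### Principal cuts, by two-valued semantics. -/

/-- The cuts permitted while the cuts on `C` are being reduced. -/
def ReducedCut (C D : Formula V ar) (Γ : Sequent V ar) : Prop :=
  AnalyticCut D Γ ∨ ArgSubformula D C

theorem ReducedCut.mono {C D : Formula V ar} {Γ Δ : Sequent V ar} (h : ReducedCut C D Γ)
    (hs : Γ ⊆ Δ) : ReducedCut C D Δ :=
  h.imp (·.mono hs) id

/-- Let `v` select the true label of each formula, and call a sequent true if it has a true member.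
A cut formula cannot be true under both labels, so structural rules preserve truth. -/
theorem Deduction.StructuralOnly.sound {S : Calculus V ar} {Ω : Set (Sequent V ar)}
    {Γ : Sequent V ar} {d : Deduction S Ω Γ} (hd : d.StructuralOnly) (v : Formula V ar → Side)
    (hΩ : ∀ Δ ∈ Ω, ∃ A ∈ Δ, A.side = v A.formula) : ∃ A ∈ Γ, A.side = v A.formula := by
  induction d with
  | hyp Γ h => exact hΩ Γ h
  | init x => cases h : v (.var x) <;> simp [h]
  | weakening Γ Δ d ih =>
    obtain ⟨A, hA, h⟩ := ih hd
    exact ⟨A, Multiset.mem_add.2 (.inl hA), h⟩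
  | contraction Γ Γ' hc d ih =>
    obtain ⟨A, hA, h⟩ := ih hd
    exact ⟨A, (hc.2 A).2 hA, h⟩
  | mcut Γ Δ C p q hp hq d₁ d₂ ih₁ ih₂ =>
    obtain ⟨A, hA, h₁⟩ := ih₁ hd.1
    obtain ⟨B, hB, h₂⟩ := ih₂ hd.2
    simp only [Multiset.mem_add, Multiset.mem_replicate] at hA hB ⊢
    rcases hA with hA | ⟨_, rfl⟩
    · exact ⟨A, .inl hA, h₁⟩
    rcases hB with hB | ⟨_, rfl⟩
    · exact ⟨B, .inr hB, h₂⟩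
    · exact absurd (h₁.trans h₂.symm) (by simp)
  | simple => exact hd.elim

namespace Calculus

variable {S : Calculus V ar}

/-- Extend `Γ` by any labelling of the proper subformulas of the principal formula. The empty
sequent is never true, so under the opposite valuation some premise is false; all its members then
lie in the labelling, and weakening applies. -/
theorem PrincipalCaseReductions.derivable (hS : S.PrincipalCaseReductions) (s : Side) {c : L}
    {args : Fin (ar c) → Formula V ar} {Λ : Fin (S.rule s c).arity → Sequent V ar}
    {Θ : Fin (S.rule s.inv c).arity → Sequent V ar} (hΛ : (args, Λ) ∈ (S.rule s c).tuples)
    (hΘ : (args, Θ) ∈ (S.rule s.inv c).tuples) {Γ : Sequent V ar}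
    (h₁ : ∀ m, Derivable S (ReducedCut (.app c args)) (Γ + Λ m))
    (h₂ : ∀ n, Derivable S (ReducedCut (.app c args)) (Γ + Θ n)) :
    Derivable S (ReducedCut (.app c args)) Γ := by
  refine Derivable.of_forall_labelling_of_finite (fun _ _ _ h hs => h.mono hs)
    (F := {A | ArgSubformula A (.app c args)})
    ((finite_subformulas (.app c args)).subset
      fun A (hA : ArgSubformula A _) => hA.subformula)
    (fun D hD => .inr hD) fun v X hX => ?_
  obtain ⟨d, hd⟩ : ∃ d : Deduction S (Set.range Λ ∪ Set.range Θ) 0, d.StructuralOnly := by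
    cases s
    · exact hS c args Λ Θ hΛ hΘ
    · rw [Set.union_comm]
      exact hS c args Θ Λ hΘ hΛ
  have hsub : ∀ Δ : Sequent V ar, (∀ A ∈ Δ, ProperSubformula A.formula (.app c args)) →
      (∀ A ∈ Δ, A.side ≠ (v A.formula).inv) → Γ + Δ ⊆ Γ + X := by
    intro Δ hΔ hv A hA
    rcases Multiset.mem_add.1 hA with hA | hA
    · exact Multiset.mem_add.2 (.inl hA)
    · refine Multiset.mem_add.2 (.inr ((hX A).2 ⟨(hΔ A hA).argSubformula, ?_⟩))
      exact ((v A.formula).eq_or_eq_inv A.side).resolve_right (hv A hA)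
  by_contra hX'
  obtain ⟨A, hA, _⟩ := hd.sound (fun A => (v A).inv) (by
    rintro Δ (⟨m, rfl⟩ | ⟨n, rfl⟩) <;> by_contra! hv
    · exact hX' ((h₁ m).mono (hsub _ ((S.rule s c).aux_proper _ _ hΛ m) hv))
    · exact hX' ((h₂ n).mono (hsub _ ((S.rule s.inv c).aux_proper _ _ hΘ n) hv)))
  simp at hA

/-! ### Replacing a labelled formula throughout a proof. -/

open Classical in
/-- Tracing the labelled formula `⟨s, C⟩` upwards in a locally analytic proof and replacing it
everywhere by `X`. The set `G` bounds the formulas that occur in the proof. -/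
theorem derivable_trace {s : Side} {c : L} {args : Fin (ar c) → Formula V ar}
    {G : Formula V ar → Prop} (hG : ∀ A B, Subformula A B → G B → G A)
    (hGC : ∀ A, ArgSubformula A (.app c args) → G A)
    {X : Sequent V ar} (hX : ∀ A ∈ X, G A.formula)
    (hctx : ∀ t e, (⟨s, .app c args⟩ : LFormula V ar) ∈ (S.rule t e).context →
      ∀ A ∈ X, A ∈ (S.rule t e).context)
    (hprin : ∀ (Θ : Sequent V ar) (Λ : Fin (S.rule s c).arity → Sequent V ar),
      (args, Λ) ∈ (S.rule s c).tuples → (∀ A ∈ Θ, A ∈ (S.rule s c).context) →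
      (∀ A ∈ Θ, G A.formula) →
      (∀ m, Derivable S (ReducedCut (.app c args)) (Θ + Λ m)) →
      Derivable S (ReducedCut (.app c args)) (Θ + X))
    {Γ : Sequent V ar} (h : Derivable S AnalyticCut Γ)
    (hΓ : ∀ A ∈ Γ, A ≠ ⟨s, .app c args⟩ → G A.formula) :
    Derivable S (ReducedCut (.app c args)) (Γ.filter (· ≠ ⟨s, .app c args⟩) + X) := by
  set C : Formula V ar := .app c args with hC
  have hskip : ∀ Δ : Sequent V ar, (⟨s, C⟩ : LFormula V ar) ∉ Δ → Derivable S AnalyticCut Δ →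
      Derivable S (ReducedCut C) (Δ.filter (· ≠ ⟨s, C⟩) + X) := by
    intro Δ hΔ h
    refine (h.imp fun _ _ => .inl).mono fun A hA => ?_
    rw [Multiset.mem_add, Multiset.mem_filter]
    exact .inl ⟨hA, fun h => hΔ (h ▸ hA)⟩
  obtain ⟨d, hd⟩ := h
  induction d with
  | hyp Γ h => exact h.elim
  | init x =>
    refine hskip _ ?_ ⟨.init x, trivial⟩
    simp [hC]
  | weakening Γ Δ d ih =>
    refine (ih (fun A hA => hΓ A (Multiset.mem_add.2 (.inl hA))) hd).mono fun A => ?_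
    simp only [Multiset.mem_add, Multiset.mem_filter]
    tauto
  | contraction Γ Γ' hc d ih =>
    refine (ih (fun A hA => hΓ A ((hc.2 A).2 hA)) hd).mono fun A => ?_
    simp only [Multiset.mem_add, Multiset.mem_filter, hc.2 A]
    tauto
  | mcut Γ Δ D p q hp hq d₁ d₂ ih₁ ih₂ =>
    by_cases hmem : (⟨s, C⟩ : LFormula V ar) ∈ Γ + Δ
    swap
    · exact hskip _ hmem ⟨.mcut Γ Δ D p q hp hq d₁ d₂, hd⟩
    -- If `C` itself is cut, the premise containing `⟨s, C⟩` as cut formula already suffices: the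
    -- trace erases it there, and the cut disappears.
    by_cases hDC : D = C
    · subst hDC
      cases s
      · refine (ih₂ (fun A hA hne => ?_) hd.2.2).mono fun A => ?_
        · rcases Multiset.mem_add.1 hA with hA | hA
          · exact hΓ A (Multiset.mem_add.2 (.inr hA)) hne
          · exact absurd (Multiset.eq_of_mem_replicate hA) hne
        · simp only [Multiset.mem_add, Multiset.mem_filter, Multiset.mem_replicate]
          tauto
      · refine (ih₁ (fun A hA hne => ?_) hd.2.1).mono fun A => ?_
        · rcases Multiset.mem_add.1 hA with hA | hA
          · exact hΓ A (Multiset.mem_add.2 (.inl hA)) hne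
          · exact absurd (Multiset.eq_of_mem_replicate hA) hne
        · simp only [Multiset.mem_add, Multiset.mem_filter, Multiset.mem_replicate]
          tauto
    · obtain ⟨⟨E, hE, hDE⟩, hd₁, hd₂⟩ := hd
      -- The witness of analyticity either survives the replacement or is `⟨s, C⟩` itself, in which
      -- case `D` is a smaller formula.
      have hD : G D ∧ ReducedCut C D ((Γ + Δ).filter (· ≠ ⟨s, C⟩) + X) := by
        by_cases hEC : E = ⟨s, C⟩
        · subst hEC
          have := hDE.eq_or_argSubformula.resolve_left hDC
          exact ⟨hGC D this, .inr this⟩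
        · refine ⟨hG D _ hDE (hΓ E hE hEC), .inl ⟨E, ?_, hDE⟩⟩
          exact Multiset.mem_add.2 (.inl (Multiset.mem_filter.2 ⟨hE, hEC⟩))
      refine Derivable.cut (fun _ _ _ h hs => h.mono hs) hD.2 .right
        ((ih₁ (fun A hA hne => ?_) hd₁).mono fun A => ?_)
        ((ih₂ (fun A hA hne => ?_) hd₂).mono fun A => ?_)
      · rcases Multiset.mem_add.1 hA with hA | hA
        · exact hΓ A (Multiset.mem_add.2 (.inl hA)) hne
        · rw [Multiset.eq_of_mem_replicate hA]
          exact hD.1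
      · simp only [Multiset.mem_add, Multiset.mem_filter, Multiset.mem_replicate,
          Multiset.mem_cons]
        tauto
      · rcases Multiset.mem_add.1 hA with hA | hA
        · exact hΓ A (Multiset.mem_add.2 (.inr hA)) hne
        · rw [Multiset.eq_of_mem_replicate hA]
          exact hD.1
      · simp only [Multiset.mem_add, Multiset.mem_filter, Multiset.mem_replicate,
          Multiset.mem_cons, Side.inv]
        tauto
  | simple t e args' prems ht Γ hΓctx d ih =>
    by_cases hmem : (⟨s, C⟩ : LFormula V ar) ∈ Γ + {⟨t, .app e args'⟩}
    swap
    · exact hskip _ hmem ⟨.simple t e args' prems ht Γ hΓctx d, hd⟩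
    have hprems : ∀ m, ∀ A ∈ prems m, G A.formula := by
      intro m A hA
      have hA' := (S.rule t e).aux_proper _ _ ht m A hA
      by_cases heq : (⟨t, .app e args'⟩ : LFormula V ar) = ⟨s, C⟩
      · have heq' : Formula.app e args' = C := congrArg LFormula.formula heq
        rw [heq'] at hA'
        exact hGC _ hA'.argSubformula
      · exact hG _ _ hA'.1 (hΓ ⟨t, .app e args'⟩ (by simp) heq)
    have hΓG : ∀ A ∈ Γ, A ≠ ⟨s, C⟩ → G A.formula := fun A hA =>
      hΓ A (Multiset.mem_add.2 (.inl hA))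
    have hctx' : (⟨s, C⟩ : LFormula V ar) ∈ Γ →
        ∀ A ∈ Γ.filter (· ≠ ⟨s, C⟩) + X, A ∈ (S.rule t e).context := by
      intro hmem A hA
      rcases Multiset.mem_add.1 hA with hA | hA
      · exact hΓctx A (Multiset.mem_filter.1 hA).1
      · exact hctx t e (hΓctx _ hmem) A hA
    have ih' : ∀ m, Derivable S (ReducedCut C) (Γ.filter (· ≠ ⟨s, C⟩) + X + prems m) := by
      intro m
      refine (ih m (fun A hA hne => ?_) (hd m)).mono fun A => ?_
      · rcases Multiset.mem_add.1 hA with hA | hA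
        · exact hΓG A hA hne
        · exact hprems m A hA
      · simp only [Multiset.mem_add, Multiset.mem_filter]
        tauto
    by_cases heq : (⟨t, .app e args'⟩ : LFormula V ar) = ⟨s, C⟩
    · obtain ⟨rfl, heq'⟩ := LFormula.mk.inj heq
      obtain ⟨rfl, hargs⟩ := Formula.app.inj heq'
      obtain rfl := eq_of_heq hargs
      by_cases hmemΓ : (⟨t, C⟩ : LFormula V ar) ∈ Γ
      · refine (hprin _ prems ht (hctx' hmemΓ) (fun A hA => ?_) ih').mono fun A => ?_
        · rcases Multiset.mem_add.1 hA with hA | hA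
          · rw [Multiset.mem_filter] at hA
            exact hΓG A hA.1 hA.2
          · exact hX A hA
        · simp only [Multiset.mem_add, Multiset.mem_filter]
          tauto
      · refine (hprin Γ prems ht hΓctx (fun A hA => hΓG A hA fun h => hmemΓ (h ▸ hA))
          fun m => ⟨d m, (hd m).imp fun _ _ => .inl⟩).mono fun A => ?_
        have : A ∈ Γ → A ≠ ⟨t, C⟩ := fun hA h => hmemΓ (h ▸ hA)
        simp only [Multiset.mem_add, Multiset.mem_filter]
        tauto
    · have hmemΓ : (⟨s, C⟩ : LFormula V ar) ∈ Γ :=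
        (Multiset.mem_add.1 hmem).resolve_right fun h => heq (Multiset.mem_singleton.1 h).symm
      refine (Derivable.simple ht (hctx' hmemΓ) ih').mono fun A => ?_
      simp only [Multiset.mem_add, Multiset.mem_filter, Multiset.mem_singleton]
      rintro ((hA | hA) | rfl)
      · exact .inl ⟨.inl hA.1, hA.2⟩
      · exact .inr hA
      · exact .inl ⟨.inr rfl, heq⟩

/-- A weakly shiftable principal formula can be replaced, in a locally analytic proof, by any
context from which the dual rule would derive its dual. -/
theorem WeaklyShiftable.derivable_replace {s : Side} {c : L} (hc : S.WeaklyShiftable s c)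
    (hS : S.PrincipalCaseReductions) {args : Fin (ar c) → Formula V ar}
    {Θ : Fin (S.rule s.inv c).arity → Sequent V ar} (hΘ : (args, Θ) ∈ (S.rule s.inv c).tuples)
    {X : Sequent V ar} (hX : ∀ A ∈ X, A ∈ (S.rule s.inv c).context)
    (h : ∀ n, Derivable S (ReducedCut (.app c args)) (X + Θ n)) {Γ : Sequent V ar}
    (hΓ : Derivable S AnalyticCut (⟨s, .app c args⟩ ::ₘ Γ)) :
    Derivable S (ReducedCut (.app c args)) (Γ + X) := by
  classical
  refine (derivable_trace (G := fun _ => True) (X := X) (fun _ _ _ _ => trivial)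
    (fun _ _ => trivial) (fun _ _ => trivial) (fun t e hte A hA => hc args t e hte (hX A hA))
    (fun Δ Λ hΛ _ _ hΔ => ?_) hΓ fun _ _ _ => trivial).mono fun A => ?_
  · refine hS.derivable s hΛ hΘ (fun m => (hΔ m).mono fun A => ?_) fun n => (h n).mono fun A => ?_
    · simp only [Multiset.mem_add]
      tauto
    · simp only [Multiset.mem_add]
      tauto
  · simp only [Multiset.mem_add, Multiset.mem_filter, Multiset.mem_cons]
    tauto

/-! ### Cut reduction for each kind of class 2 connective. -/

/-- Reducibility of the cuts on `C` to analytic cuts and cuts on smaller formulas. -/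
def CutReducible (S : Calculus V ar) (C : Formula V ar) : Prop :=
  ∀ Γ : Sequent V ar, Derivable S AnalyticCut (⟨.right, C⟩ ::ₘ Γ) →
    Derivable S AnalyticCut (⟨.left, C⟩ ::ₘ Γ) → Derivable S (ReducedCut C) Γ

theorem cutReducible_of_side (s : Side) {C : Formula V ar}
    (h : ∀ Γ : Sequent V ar, Derivable S AnalyticCut (⟨s, C⟩ ::ₘ Γ) →
      Derivable S AnalyticCut (⟨s.inv, C⟩ ::ₘ Γ) → Derivable S (ReducedCut C) Γ) :
    S.CutReducible C := by
  cases s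
  · exact fun Γ h₁ h₂ => h Γ h₂ h₁
  · exact fun Γ h₁ h₂ => h Γ h₁ h₂

theorem Invertible.derivable {s : Side} {c : L} (hc : S.Invertible s c)
    {args : Fin (ar c) → Formula V ar} {Λ : Fin (S.rule s c).arity → Sequent V ar}
    (hΛ : (args, Λ) ∈ (S.rule s c).tuples) {Γ : Sequent V ar}
    (h : Derivable S AnalyticCut (⟨s, .app c args⟩ ::ₘ Γ)) (m : Fin (S.rule s c).arity) :
    Derivable S (ReducedCut (.app c args)) (Γ + Λ m) := by
  rw [← Multiset.singleton_add, add_comm] at h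
  obtain ⟨d, hd⟩ := h
  obtain ⟨d', _, hd'⟩ := hc args Λ hΛ Γ d m
  exact ⟨d', (hd' hd).imp fun _ _ h => h.imp id ProperSubformula.argSubformula⟩

theorem cutReducible_of_invertible (hS : S.PrincipalCaseReductions) {c : L}
    (hl : S.Invertible .left c) (hr : S.Invertible .right c) (args : Fin (ar c) → Formula V ar) :
    S.CutReducible (.app c args) := by
  intro Γ h₁ h₂
  obtain ⟨Λ, hΛ⟩ := (S.rule .left c).total args
  obtain ⟨Θ, hΘ⟩ := (S.rule .right c).total args
  exact hS.derivable .left hΛ hΘ (hl.derivable hΛ h₂) (hr.derivable hΘ h₁)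

theorem cutReducible_of_shiftable (hS : S.PrincipalCaseReductions) {s : Side} {c : L}
    (hs : S.Shiftable s c) (hw : S.WeaklyShiftable s.inv c) (args : Fin (ar c) → Formula V ar) :
    S.CutReducible (.app c args) := by
  classical
  refine cutReducible_of_side s fun Γ h₁ h₂ => ?_
  refine (derivable_trace (s := s) (G := fun _ => True) (X := Γ) (fun _ _ _ _ => trivial)
    (fun _ _ => trivial) (fun _ _ => trivial) (fun t e hte A _ => ?_)
    (fun Δ Λ hΛ hΔ _ h => ?_) h₁ fun _ _ _ => trivial).mono fun A => ?_
  · rw [hs args t e hte]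
    trivial
  · have hinv : s.inv.inv = s := s.inv_inv
    rw [add_comm]
    -- The transport is needed because `s.inv.inv` reduces to `s` only after a case split on `s`.
    refine hw.derivable_replace hS (Θ := fun n => Λ (hinv ▸ n)) ?_ ?_ ?_ h₂ <;> cases s <;>
      assumption
  · simp only [Multiset.mem_add, Multiset.mem_filter, Multiset.mem_cons]
    tauto

theorem cutReducible_of_inverseShiftable (hS : S.PrincipalCaseReductions)
    (hA : S.AxiomExpansion) {s : Side} {c : L} (hw : S.WeaklyShiftable s c)
    (hi : S.InverseShiftable s.inv c) (args : Fin (ar c) → Formula V ar) :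
    S.CutReducible (.app c args) := by
  classical
  refine cutReducible_of_side s fun Γ h₁ h₂ => ?_
  set C : Formula V ar := .app c args
  -- Exactly formulas on which cuts are permitted; by local analyticity they also bound what the
  -- trace can meet.
  set F : Set (Formula V ar) := {A | (∃ B ∈ Γ, Subformula A B.formula) ∨ ArgSubformula A C}
  have hFfin : F.Finite := by
    refine Set.Finite.union ?_
      ((finite_subformulas C).subset fun A (hA : ArgSubformula A C) => hA.subformula)
    refine (Γ.finite_toSet.biUnion fun B _ => finite_subformulas B.formula).subset ?_
    rintro A ⟨B, hB, hAB⟩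
    exact Set.mem_biUnion hB hAB
  refine Derivable.of_forall_labelling_of_finite (fun _ _ _ h hs => h.mono hs) hFfin
    (fun D hD => hD) fun v X hX => ?_
  -- Does some part of the labelling serve as a context for introducing `⟨s.inv, C⟩`, with derivable
  -- premises?
  by_cases hexit : ∃ (Δ : Sequent V ar) (Θ : Fin (S.rule s.inv c).arity → Sequent V ar),
      Δ ⊆ X ∧ (args, Θ) ∈ (S.rule s.inv c).tuples ∧
      (∀ A ∈ Δ, A ∈ (S.rule s.inv c).context) ∧ ∀ n, Derivable S (ReducedCut C) (Δ + Θ n)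
  · obtain ⟨Δ, Θ, hΔX, hΘ, hΔ, h⟩ := hexit
    refine (hw.derivable_replace hS hΘ hΔ h h₁).mono fun A => ?_
    simp only [Multiset.mem_add]
    exact Or.imp id fun h => hΔX h
  -- Keep just the labelled formulas whose inverses the rule for `⟨s.inv, C⟩` admits: inverse
  -- shiftability lets these pass wherever `⟨s.inv, C⟩` does.
  · refine (derivable_trace (s := s.inv) (G := (· ∈ F))
      (X := X.filter fun A => A.inv ∈ (S.rule s.inv c).context) ?_ (fun A h => .inr h)
      (fun A hA => ((hX A).1 (Multiset.mem_filter.1 hA).1).1) (fun t e hte A hA => ?_)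
      (fun Δ Θ hΘ hΔ hΔF h => ?_) h₂ fun A hA hne => ?_).mono fun A => ?_
    · rintro A B hAB (⟨D, hD, hBD⟩ | hB)
      · exact .inl ⟨D, hD, hAB.trans hBD⟩
      · exact .inr (hAB.trans_argSubformula hB)
    · exact hi args t e hte ⟨A.inv, (Multiset.mem_filter.1 hA).2, A.inv_inv⟩
    -- As `Δ` is not part of the labelling, some `A` in it has `A.inv` in the labelling, giving an
    -- instance of axiom expansion.
    · obtain ⟨A, hAΔ, hAX⟩ : ∃ A ∈ Δ, A ∉ X := by
        by_contra! hsub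
        exact hexit ⟨Δ, Θ, fun A hA => hsub A hA, hΘ, hΔ, h⟩
      refine Derivable.of_axiomExpansion hA (A := A) (Multiset.mem_add.2 (.inl hAΔ))
        (Multiset.mem_add.2 (.inr (Multiset.mem_filter.2 ⟨(hX _).2 ⟨hΔF A hAΔ, ?_⟩, ?_⟩)))
      · have hne : A.side ≠ v A.formula := fun h => hAX ((hX A).2 ⟨hΔF A hAΔ, h⟩)
        have := (A.side.eq_or_eq_inv (v A.formula)).resolve_left hne.symm
        exact this.symm
      · simpa using hΔ A hAΔ
    · exact .inl ⟨A, (Multiset.mem_cons.1 hA).resolve_left hne, .refl _⟩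
    · simp only [Multiset.mem_add, Multiset.mem_filter, Multiset.mem_cons]
      tauto

theorem ClassTwo.cutReducible {c : L} (hc : S.ClassTwo c) (hS : S.PrincipalCaseReductions)
    (hA : S.AxiomExpansion) (args : Fin (ar c) → Formula V ar) :
    S.CutReducible (.app c args) := by
  rcases hc with (⟨h₁, h₂⟩ | ⟨h₁, h₂⟩ | ⟨h₁, h₂⟩) | ⟨h₁, h₂⟩ | ⟨h₁, h₂⟩
  · exact cutReducible_of_invertible hS h₁ h₂ args
  · exact cutReducible_of_shiftable hS (s := .left) h₁ h₂ args
  · exact cutReducible_of_shiftable hS (s := .right) h₁ h₂ args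
  · exact cutReducible_of_inverseShiftable hS hA (s := .left) h₁ h₂ args
  · exact cutReducible_of_inverseShiftable hS hA (s := .right) h₁ h₂ args

end Calculus

/-! ### Substitution and cuts on variables. -/

/-- Substitution preserves subformulas, hence analyticity of cuts; only initial sequents need
repair, by axiom expansion. -/
theorem Derivable.subst {S : Calculus V ar} (hA : S.AxiomExpansion) {Γ : Sequent V ar}
    (h : Derivable S AnalyticCut Γ) (x : V) (D : Formula V ar) :
    Derivable S AnalyticCut (Γ.map (LFormula.subst x D)) := by
  obtain ⟨d, hd⟩ := h
  induction d with
  | hyp Γ h => exact h.elim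
  | init y =>
    exact Derivable.of_axiomExpansion hA
      (A := LFormula.subst x D ⟨.left, .var y⟩) (by simp)
      (by simp [LFormula.subst, LFormula.inv, Side.inv])
  | weakening Γ Δ d ih => exact (ih hd).mono (Multiset.map_subset_map
    (Multiset.subset_of_le (Multiset.le_add_right _ _)))
  | contraction Γ Γ' hc d ih =>
    exact (ih hd).mono (Multiset.map_subset_map fun A hA => (hc.2 A).2 hA)
  | mcut Γ Δ C p q hp hq d₁ d₂ ih₁ ih₂ =>
    obtain ⟨⟨E, hE, hCE⟩, hd₁, hd₂⟩ := hd
    refine Derivable.cut (C := Formula.subst x D C) (fun _ _ _ h hs => h.mono hs)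
      ⟨LFormula.subst x D E, Multiset.mem_map_of_mem _ hE, hCE.subst x D⟩ .right
      ((ih₁ hd₁).mono fun A => ?_) ((ih₂ hd₂).mono fun A => ?_)
    · simp only [Multiset.map_add, Multiset.map_replicate, Multiset.mem_add,
        Multiset.mem_replicate, Multiset.mem_cons, LFormula.subst]
      tauto
    · simp only [Multiset.map_add, Multiset.map_replicate, Multiset.mem_add,
        Multiset.mem_replicate, Multiset.mem_cons, LFormula.subst, Side.inv]
      tauto
  | simple s c args prems ht Γ hΓ d ih =>
    have := Derivable.simple (S := S) (P := AnalyticCut) (Γ := Γ.map (LFormula.subst x D))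
      ((S.rule s c).tuples_subst args prems ht x D) (fun A hA => ?_)
      (fun m => by simpa using ih m (hd m))
    · simpa [LFormula.subst, Formula.subst] using this
    · obtain ⟨B, hB, rfl⟩ := Multiset.mem_map.1 hA
      exact (S.rule s c).context_subst B (hΓ B hB) x D

theorem Calculus.IsClassTwo.derivable_cut_var {S : Calculus V ar} (hS : S.IsClassTwo) {x : V}
    {Γ : Sequent V ar} (h₁ : Derivable S AnalyticCut (⟨.right, .var x⟩ ::ₘ Γ))
    (h₂ : Derivable S AnalyticCut (⟨.left, .var x⟩ ::ₘ Γ)) : Derivable S AnalyticCut Γ := by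
  by_cases hx : AnalyticCut (.var x) Γ
  · exact Derivable.cut (fun _ _ _ h hs => h.mono hs) hx .right h₁ h₂
  obtain ⟨A, hA⟩ : ∃ A, A ∈ Γ := by
    refine Multiset.exists_mem_of_ne_zero ?_
    rintro rfl
    obtain ⟨d, _⟩ := Derivable.cut (P := fun _ _ => True) (fun _ _ _ _ _ => trivial) trivial
      .right (h₁.imp fun _ _ _ => trivial) (h₂.imp fun _ _ _ => trivial)
    exact hS.consistent ⟨d⟩
  have hΓ : Γ.map (LFormula.subst x A.formula) = Γ := by
    conv_rhs => rw [← Multiset.map_id Γ]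
    refine Multiset.map_congr rfl fun B hB => ?_
    ext
    · rfl
    · exact Formula.subst_eq_self (B := B.formula) _ fun h => hx ⟨B, hB, h⟩
  have key : ∀ s : Side, Derivable S AnalyticCut (⟨s, .var x⟩ ::ₘ Γ) →
      Derivable S AnalyticCut (⟨s, A.formula⟩ ::ₘ Γ) := fun s h => by
    have := h.subst hS.axiomExpansion x A.formula
    rw [Multiset.map_cons, hΓ, LFormula.subst] at this
    simpa only [Formula.subst_var_self] using this
  exact Derivable.cut (C := A.formula) (fun _ _ _ h hs => h.mono hs) ⟨A, hA, .refl _⟩ .right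
    (key _ h₁) (key _ h₂)

/-! ### Induction on the cut formula. -/

theorem Derivable.of_reducedCut {S : Calculus V ar} {C : Formula V ar}
    (hC : ∀ D, ArgSubformula D C → ∀ Γ : Sequent V ar,
      Derivable S AnalyticCut (⟨.right, D⟩ ::ₘ Γ) → Derivable S AnalyticCut (⟨.left, D⟩ ::ₘ Γ) →
      Derivable S AnalyticCut Γ)
    {Γ : Sequent V ar} (h : Derivable S (ReducedCut C) Γ) : Derivable S AnalyticCut Γ := by
  obtain ⟨d, hd⟩ := h
  induction d with
  | hyp Γ h => exact h.elim
  | init x => exact ⟨.init x, trivial⟩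
  | weakening Γ Δ d ih => exact (ih hd).mono (Multiset.subset_of_le (Multiset.le_add_right _ _))
  | contraction Γ Γ' hc d ih => exact (ih hd).mono fun A hA => (hc.2 A).2 hA
  | mcut Γ Δ D p q hp hq d₁ d₂ ih₁ ih₂ =>
    obtain ⟨hD, hd₁, hd₂⟩ := hd
    have h₁ : Derivable S AnalyticCut (⟨.right, D⟩ ::ₘ (Γ + Δ)) := (ih₁ hd₁).mono fun A => by
      simp only [Multiset.mem_add, Multiset.mem_replicate, Multiset.mem_cons]
      tauto
    have h₂ : Derivable S AnalyticCut (⟨.left, D⟩ ::ₘ (Γ + Δ)) := (ih₂ hd₂).mono fun A => by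
      simp only [Multiset.mem_add, Multiset.mem_replicate, Multiset.mem_cons]
      tauto
    rcases hD with hD | hD
    · exact Derivable.cut (fun _ _ _ h hs => h.mono hs) hD .right h₁ h₂
    · exact hC D hD _ h₁ h₂
  | simple s c args prems ht Γ hΓ d ih => exact Derivable.simple ht hΓ fun m => ih m (hd m)

/-- Quantifying over all subformulas `D` of `C` makes structural induction reach every proper
subformula, beyond the immediate arguments. -/
theorem Calculus.IsClassTwo.derivable_cut {S : Calculus V ar} (hS : S.IsClassTwo)
    (C : Formula V ar) : ∀ D, Subformula D C → ∀ Γ : Sequent V ar,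
      Derivable S AnalyticCut (⟨.right, D⟩ ::ₘ Γ) → Derivable S AnalyticCut (⟨.left, D⟩ ::ₘ Γ) →
      Derivable S AnalyticCut Γ := by
  induction C with
  | var x =>
    intro D hD Γ h₁ h₂
    cases hD
    exact hS.derivable_cut_var h₁ h₂
  | app c args ih =>
    intro D hD Γ h₁ h₂
    rcases hD.eq_or_argSubformula with rfl | ⟨i, hi⟩
    · refine Derivable.of_reducedCut (C := .app c args) (fun E hE => ?_) ?_
      · obtain ⟨i, hi⟩ := hE
        exact ih i E hi
      · exact (hS.connectives c).cutReducible hS.principalCaseReductions hS.axiomExpansion args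
          Γ h₁ h₂
    · exact ih i D hi Γ h₁ h₂

end SeqCalc

theorem mainTheorem1 {V : Type*} {L : Type*} {ar : L → ℕ} (S : SeqCalc.Calculus V ar)
    (hS : S.IsClassTwo) : S.AnalyticCutProperty := by
  rintro Γ ⟨d⟩
  have key : ∀ Γ : SeqCalc.Sequent V ar, SeqCalc.Proof S Γ →
      SeqCalc.Derivable S SeqCalc.AnalyticCut Γ := by
    intro Γ d
    induction d with
    | hyp Γ h => exact h.elim
    | init x => exact ⟨.init x, trivial⟩
    | weakening Γ Δ d ih => exact ih.mono (Multiset.subset_of_le (Multiset.le_add_right _ _))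
    | contraction Γ Γ' hc d ih => exact ih.mono fun A hA => (hc.2 A).2 hA
    | mcut Γ Δ D p q hp hq d₁ d₂ ih₁ ih₂ =>
      refine hS.derivable_cut D D (.refl D) _ (ih₁.mono fun A => ?_) (ih₂.mono fun A => ?_)
      · simp only [Multiset.mem_add, Multiset.mem_replicate, Multiset.mem_cons]
        tauto
      · simp only [Multiset.mem_add, Multiset.mem_replicate, Multiset.mem_cons]
        tauto
    | simple s c args prems ht Γ hΓ d ih => exact SeqCalc.Derivable.simple ht hΓ ih
  exact key Γ d
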